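/- Let $S$ be a regular local ring with maximal ideal $M$, and let $x=(x_1,\dots,x_n)$ be a sequence in $S$ which generates $M$ minimally (that is, $x_1,\dots,x_n$ generate $M$ and no $x_i$ can be omitted). Let $\varphi\in S^{n\times n}$ be a matrix and let $a=(a_1,\dots,a_n)=x\cdot\varphi$ be the product of the row matrix $x$ with $\varphi$. Denote by $J(a)$ the ideal of $S$ generated by $a_1,\dots,a_n$. Then $\det(\varphi)\notin J(a)$ if and only if $a$ is a maximal regular sequence in $S$, i.e. $a_1,\dots,a_n$ is a regular sequence in $S$ and there is no $s\in S$ such that $a_1,\dots,a_n,s$ is a regular sequence in $S$. (A sequence $b_1,\dots,b_m$ in $S$ is regular if $b_i$ is a non-zero-divisor on $S/(b_1,\dots,b_{i-1})$ for $i=1,\dots,m$ and $(b_1,\dots,b_m)\neq S$.) -/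

import Mathlib

/-- The ideal `J(a)` generated by the entries of a finite sequence (row matrix) `a`. -/
def idealOfSeq {A : Type*} [CommRing A] {n : ℕ} (a : Fin n → A) : Ideal A :=
  Ideal.span (Set.range a)

/-- The sequence `x` generates the ideal `I` minimally: it generates `I`, and no entry of the
sequence can be dropped. -/
def GeneratesMinimally {A : Type*} [CommRing A] {n : ℕ} (x : Fin n → A) (I : Ideal A) : Prop :=
  idealOfSeq x = I ∧ ∀ i : Fin n, Ideal.span (x '' {j | j ≠ i}) ≠ I

/-- `a` is a maximal regular sequence in `A`: it is a regular sequence on the ring `A` (in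
particular `J(a) ≠ A`), and it cannot be prolonged to a longer regular sequence. -/
def IsMaximalRegularSequence {A : Type*} [CommRing A] {n : ℕ} (a : Fin n → A) : Prop :=
  RingTheory.Sequence.IsRegular A (List.ofFn a) ∧
    ∀ s : A, ¬ RingTheory.Sequence.IsRegular A (List.ofFn a ++ [s])

/-!
Write `M` for the maximal ideal and `J(a)` for the ideal generated by a tuple `a`. Minimality of
`x` forces `n = dim S`. By Cramer's rule `det φ • M ⊆ J(a)` for `a = x φ`.

If `a` is regular, then `det φ` generates the socle of `S / J(a)`: it is not in `J(a)`, and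
`(J(a) : M) = J(a) + (det φ)` (`det_notMem_and_colon_le`). This is an induction on `n`: an element
`y ∈ M \ M ^ 2` that is regular modulo `a₁, …, aₙ` is exchanged for `a₀`, and the claim for
`S / (y)` is transported back along `δ a₀ ≡ det φ · y mod (a₁, …, aₙ)`, where `δ` is the
complementary minor. Since `det φ` is annihilated by `M` modulo `J(a)`, no further element
prolongs `a`.

For the converse, assume `det φ ∉ J(a)`. By Krull's intersection theorem `det φ ∉ J(a) + M ^ k`
for some `k`. Since `S` is Cohen-Macaulay, which is proved here in the form that fewer than `dim S`
elements forming a regular sequence leave no socle (`socleFree_of_isWeaklyRegular`), prime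
avoidance yields a perturbation `ψ` of `φ` with entries in `M ^ k` such that `c = x (φ + ψ)` is
regular. If `M ^ k` were not contained in `J(c)`, then the Artinian ring `S / J(c)` would have a
nonzero socle element coming from `M ^ k`. As the socle is generated by `det (φ + ψ)`, which is
congruent to `det φ` modulo `M ^ k`, this would give `det φ ∈ J(a) + M ^ k`. Hence
`M ^ k ⊆ J(c)`, so `a` and `c` differ by elements of `M J(c)`, and replacing the entries of `c` one
at a time by those of `a` preserves regularity (`isWeaklyRegular_of_sub_mem`).
-/

open IsLocalRing RingTheory.Sequence

/-! ### Prime avoidance in cosets of powers of the maximal ideal -/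

/-- Prime avoidance for the coset `a + M ^ k` in a local ring. For a single `r ∈ M` outside the
given primes, two of the elements `a + r ^ i` cannot lie in the same prime, because
`1 - r ^ d` is a unit for `d > 0`; so one of these elements avoids the finitely many primes. -/
lemma exists_add_mem_pow_notMem {R : Type*} [CommRing R] [IsLocalRing R] {T : Set (Ideal R)}
    (hT : T.Finite) (hprime : ∀ P ∈ T, P.IsPrime) (hne : ∀ P ∈ T, P ≠ maximalIdeal R)
    (a : R) (k : ℕ) : ∃ r ∈ maximalIdeal R ^ k, ∀ P ∈ T, a + r ∉ P := by
  obtain ⟨r, hr, hrT⟩ : ∃ r ∈ maximalIdeal R, ∀ P ∈ T, r ∉ P := by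
    by_contra! h
    obtain ⟨P, hP, hle⟩ := (Ideal.subset_union_prime_finite hT (f := id) ⊥ ⊥
      (fun P hP _ _ ↦ hprime P hP)).mp (show (maximalIdeal R : Set R) ⊆ _ from fun r hr ↦ by
        simpa using h r hr)
    exact hne P hP (((maximalIdeal.isMaximal R).eq_of_le (hprime P hP).ne_top hle).symm)
  by_contra! h
  choose f hfT hf using fun i : ℕ ↦
    h (r ^ (k + i)) (Ideal.pow_le_pow_right (Nat.le_add_right k i) (Ideal.pow_mem_pow hr _))
  have := hT.to_subtype
  obtain ⟨i, j, hij, hfij⟩ := Finite.exists_ne_map_eq_of_infinite (fun i ↦ (⟨f i, hfT i⟩ : T))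
  wlog hlt : i < j generalizing i j
  · exact this j i hij.symm hfij.symm (lt_of_le_of_ne (not_lt.mp hlt) hij.symm)
  have hfij : f i = f j := congrArg Subtype.val hfij
  obtain ⟨d, rfl⟩ := Nat.exists_eq_add_of_lt hlt
  have := hprime _ (hfT i)
  have hmem : r ^ (k + i) * (1 - r ^ (d + 1)) ∈ f i := by
    have := (f i).sub_mem (hf i) (hfij ▸ hf (i + d + 1))
    convert this using 1
    ring
  have hu : IsUnit (1 - r ^ (d + 1)) := by
    by_contra hu
    have h1 := (maximalIdeal R).add_mem ((mem_maximalIdeal _).mpr hu)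
      ((maximalIdeal R).pow_mem_of_mem hr (d + 1) d.succ_pos)
    simp at h1
  rw [Ideal.mul_unit_mem_iff_mem _ hu] at hmem
  exact hrT _ (hfT i) (this.mem_of_pow_mem _ hmem)

/-- `R / J` has zero socle: no nonzero class of `R / J` is annihilated by the maximal ideal. For
Noetherian `R` this says that the maximal ideal is not an associated prime of `R / J`. The
condition is stated on representatives, so that no quotient module is involved. -/
def SocleFree {R : Type*} [CommRing R] [IsLocalRing R] (J : Ideal R) : Prop :=
  ∀ t : R, (∀ m ∈ maximalIdeal R, t * m ∈ J) → t ∈ J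

lemma SocleFree.exists_add_regular {R : Type*} [CommRing R] [IsLocalRing R] [IsNoetherianRing R]
    {J : Ideal R} (hJ : SocleFree J) (a : R) (k : ℕ) :
    ∃ r ∈ maximalIdeal R ^ k, ∀ t, (a + r) * t ∈ J → t ∈ J := by
  obtain ⟨r, hr, hrT⟩ := exists_add_mem_pow_notMem (associatedPrimes.finite R (R ⧸ J))
    (fun P hP ↦ hP.isPrime) (fun P hP hPM ↦ by
      obtain ⟨hprime, s, hs⟩ := (isAssociatedPrime_iff).mp hP
      obtain ⟨t, rfl⟩ := Ideal.Quotient.mk_surjective s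
      refine hprime.ne_top ?_
      have : t ∈ J := hJ t fun m hm ↦ by
        rw [← hPM, hs, Submodule.mem_colon_singleton] at hm
        rw [← Ideal.Quotient.eq_zero_iff_mem, mul_comm]
        simpa [Algebra.smul_def] using hm
      rw [hs, Ideal.Quotient.eq_zero_iff_mem.mpr this]
      simp) a k
  refine ⟨r, hr, ?_⟩
  have h : a + r ∉ ⋃ p ∈ associatedPrimes R (R ⧸ J), (p : Set R) := by simpa using hrT
  rw [biUnion_associatedPrimes_eq_compl_regular] at h
  simpa [isSMulRegular_quotient_iff_mem_of_smul_mem] using h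

/-! ### Regular sequences and quotients by one element -/

lemma isWeaklyRegular_append_singleton_iff {R : Type*} [CommRing R] (L : List R) (s : R) :
    IsWeaklyRegular R (L ++ [s]) ↔
      IsWeaklyRegular R L ∧ ∀ t, s * t ∈ Ideal.ofList L → t ∈ Ideal.ofList L := by
  rw [isWeaklyRegular_append_iff, isWeaklyRegular_singleton_iff,
    isSMulRegular_quotient_iff_mem_of_smul_mem]
  simp

lemma isWeaklyRegular_cons_iff_quotient {R : Type*} [CommRing R] (s : R) (L : List R) :
    IsWeaklyRegular R (s :: L) ↔ IsSMulRegular R s ∧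
      IsWeaklyRegular (R ⧸ Ideal.span {s}) (L.map (Ideal.Quotient.mk (Ideal.span {s}))) := by
  rw [isWeaklyRegular_cons_iff]
  refine and_congr_right fun _ ↦ ?_
  rw [← Ideal.Quotient.algebraMap_eq, isWeaklyRegular_map_algebraMap_iff]
  refine (Submodule.quotEquivOfEq _ _ ?_).isWeaklyRegular_congr L
  rw [← Submodule.ideal_span_singleton_smul, smul_eq_mul, Ideal.mul_top]

lemma Ideal.ofList_ofFn {R : Type*} [CommRing R] {n : ℕ} (a : Fin n → R) :
    Ideal.ofList (List.ofFn a) = Ideal.span (Set.range a) := by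
  change Ideal.span {r | r ∈ List.ofFn a} = _
  congr 1
  ext
  simp [List.mem_ofFn]

lemma mk_mem_span_range_iff {R : Type*} [CommRing R] {n : ℕ} (y : R) (a : Fin n → R) (t : R) :
    Ideal.Quotient.mk (Ideal.span {y}) t ∈
      Ideal.span (Set.range fun j ↦ Ideal.Quotient.mk (Ideal.span {y}) (a j)) ↔
      t ∈ Ideal.span {y} ⊔ Ideal.span (Set.range a) := by
  rw [show (fun j ↦ Ideal.Quotient.mk (Ideal.span {y}) (a j)) =
    Ideal.Quotient.mk (Ideal.span {y}) ∘ a from rfl, Set.range_comp, ← Ideal.map_span,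
    ← Ideal.mem_comap, Ideal.comap_map_of_surjective' _ Ideal.Quotient.mk_surjective,
    Ideal.mk_ker, sup_comm]

/-! ### Quotients by an element outside the square of the maximal ideal -/

/-- An element `y ∈ M \ M ^ 2` can be exchanged for one of the `n + 1` generators of `M`, since some
coefficient of `y` with respect to the generators is a unit. -/
lemma exists_span_pair_eq_maximalIdeal {R : Type*} [CommRing R] [IsLocalRing R] {n : ℕ}
    {x : Fin (n + 1) → R} (hx : Ideal.span (Set.range x) = maximalIdeal R) {y : R}
    (hy : y ∈ maximalIdeal R) (hy2 : y ∉ maximalIdeal R ^ 2) :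
    ∃ x' : Fin n → R, Ideal.span {y} ⊔ Ideal.span (Set.range x') = maximalIdeal R := by
  obtain ⟨c, hc⟩ := (Ideal.mem_span_range_iff_exists_fun).mp (hx.symm ▸ hy)
  have hxm (i) : x i ∈ maximalIdeal R := hx ▸ Ideal.subset_span ⟨i, rfl⟩
  obtain ⟨i, hi⟩ : ∃ i, IsUnit (c i) := by
    by_contra! h
    exact hy2 (hc ▸ Ideal.sum_mem _ fun i _ ↦ by
      rw [pow_two]; exact Ideal.mul_mem_mul ((mem_maximalIdeal _).mpr (h i)) (hxm i))
  refine ⟨fun j ↦ x (i.succAbove j), le_antisymm ?_ ?_⟩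
  · rw [sup_le_iff, Ideal.span_le, Ideal.span_le]
    refine ⟨by simpa using hy, ?_⟩
    rintro _ ⟨j, rfl⟩
    exact hxm _
  · have hj (j) : x (i.succAbove j) ∈
        Ideal.span {y} ⊔ Ideal.span (Set.range fun j ↦ x (i.succAbove j)) :=
      Ideal.mem_sup_right (Ideal.subset_span ⟨j, rfl⟩)
    rw [← hx, Ideal.span_le]
    rintro _ ⟨k, rfl⟩
    rcases Fin.eq_self_or_eq_succAbove i k with rfl | ⟨j, rfl⟩
    · rw [SetLike.mem_coe, ← Ideal.unit_mul_mem_iff_mem _ hi]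
      rw [Fin.sum_univ_succAbove _ k] at hc
      rw [eq_sub_of_add_eq hc]
      exact Ideal.sub_mem _ (Ideal.mem_sup_left (Ideal.mem_span_singleton_self y))
        (Ideal.sum_mem _ fun j _ ↦ Ideal.mul_mem_left _ _ (hj j))
    · exact hj j

lemma isLocalRing_quotient_span_singleton {R : Type*} [CommRing R] [IsLocalRing R] {y : R}
    (hy : y ∈ maximalIdeal R) : IsLocalRing (R ⧸ Ideal.span {y}) := by
  have : Nontrivial (R ⧸ Ideal.span {y}) := Ideal.Quotient.nontrivial_iff.mpr fun h ↦
    (mem_maximalIdeal y).mp hy (Ideal.span_singleton_eq_top.mp h)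
  exact .of_surjective' _ Ideal.Quotient.mk_surjective

lemma mk_mem_maximalIdeal_iff {R : Type*} [CommRing R] [IsLocalRing R] {I : Ideal R}
    [IsLocalRing (R ⧸ I)] (t : R) :
    Ideal.Quotient.mk I t ∈ maximalIdeal (R ⧸ I) ↔ t ∈ maximalIdeal R := by
  have := IsLocalHom.of_surjective (Ideal.Quotient.mk I) Ideal.Quotient.mk_surjective
  simp [mem_maximalIdeal]

lemma span_range_mk_eq_maximalIdeal {R : Type*} [CommRing R] [IsLocalRing R] {n : ℕ} {y : R}
    {x : Fin n → R} (hx : Ideal.span {y} ⊔ Ideal.span (Set.range x) = maximalIdeal R)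
    [IsLocalRing (R ⧸ Ideal.span {y})] :
    Ideal.span (Set.range fun j ↦ Ideal.Quotient.mk (Ideal.span {y}) (x j)) =
      maximalIdeal (R ⧸ Ideal.span {y}) := by
  ext t
  obtain ⟨t, rfl⟩ := Ideal.Quotient.mk_surjective t
  rw [mk_mem_span_range_iff, hx, mk_mem_maximalIdeal_iff]

lemma ringKrullDim_le_of_span_range_eq_maximalIdeal {R : Type*} [CommRing R] [IsLocalRing R]
    [IsNoetherianRing R] {n : ℕ}
    {x : Fin n → R} (hx : Ideal.span (Set.range x) = maximalIdeal R) : ringKrullDim R ≤ n := by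
  refine (ringKrullDim_le_spanFinrank_maximalIdeal R).trans ?_
  rw [← hx]
  have := Submodule.spanFinrank_span_le_ncard_of_finite (R := R) (Set.finite_range x)
  have h2 : (Set.range x).ncard ≤ n := by
    simpa [Set.image_univ, Set.ncard_univ] using Set.ncard_image_le (f := x) (s := Set.univ)
  exact_mod_cast this.trans h2

lemma ringKrullDim_quotient_eq {R : Type*} [CommRing R] [IsLocalRing R] [IsNoetherianRing R]
    {n : ℕ} (hdim : ringKrullDim R = (n + 1 : ℕ)) {y : R}
    {x : Fin n → R} (hx : Ideal.span {y} ⊔ Ideal.span (Set.range x) = maximalIdeal R) :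
    ringKrullDim (R ⧸ Ideal.span {y}) = n := by
  have hy : y ∈ maximalIdeal R := hx ▸ Ideal.mem_sup_left (Ideal.mem_span_singleton_self y)
  have := isLocalRing_quotient_span_singleton hy
  refine le_antisymm
    (ringKrullDim_le_of_span_range_eq_maximalIdeal (span_range_mk_eq_maximalIdeal hx)) ?_
  have h : ringKrullDim R ≤ ringKrullDim (R ⧸ Ideal.span {y}) + 1 := by
    rw [← maximalIdeal_height_eq_ringKrullDim]
    exact Ideal.height_le_ringKrullDim_quotient_add_one hy
  rw [hdim] at h
  revert h
  generalize ringKrullDim (R ⧸ Ideal.span {y}) = d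
  intro h
  induction d with
  | bot => simp at h
  | coe d =>
    norm_cast at h ⊢
    exact (ENat.add_le_add_iff_right (by simp)).mp h

lemma exists_mem_maximalIdeal_notMem_sq {R : Type*} [CommRing R] [IsLocalRing R]
    [IsNoetherianRing R] (h : maximalIdeal R ≠ ⊥) :
    ∃ y ∈ maximalIdeal R, y ∉ maximalIdeal R ^ 2 := by
  by_contra! hle
  exact h (Submodule.eq_bot_of_le_smul_of_le_jacobson_bot _ _ (IsNoetherian.noetherian _)
    (by rw [smul_eq_mul, ← pow_two]; exact hle) (maximalIdeal_le_jacobson _))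

/-! ### Regular local rings are domains and have maximal depth -/

/-- A Noetherian local ring of dimension `n` whose maximal ideal has `n` generators is a domain.
For `y ∈ M \ M ^ 2` outside all minimal primes, `(y)` is prime by induction, and a minimal prime
`p ≤ (y)` satisfies `p = y p`, hence `p = 0`. -/
theorem isDomain_of_span_range_eq_maximalIdeal {R : Type*} [CommRing R] [IsLocalRing R]
    [IsNoetherianRing R] {n : ℕ} (hdim : ringKrullDim R = n)
    {x : Fin n → R} (hx : Ideal.span (Set.range x) = maximalIdeal R) : IsDomain R := by
  induction n generalizing R with
  | zero =>
    have : IsField R := isField_iff_maximalIdeal_eq.mpr (by simpa using hx.symm)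
    exact this.isDomain
  | succ n ih =>
    have hM : maximalIdeal R ∉ minimalPrimes R := fun h ↦ by
      have h0 : (maximalIdeal R).height = 0 := Ideal.height_eq_zero_iff.mpr h
      rw [← maximalIdeal_height_eq_ringKrullDim, h0] at hdim
      norm_cast at hdim
    have hbot : maximalIdeal R ≠ ⊥ := fun h ↦ hM <| by
      obtain ⟨p, hp, hle⟩ := Ideal.exists_minimalPrimes_le (bot_le (a := maximalIdeal R))
      rwa [h, ← le_bot_iff.mp (h ▸ hle)]
    obtain ⟨y₀, hy₀, hy₀2⟩ := exists_mem_maximalIdeal_notMem_sq hbot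
    obtain ⟨r, hr, hrT⟩ := exists_add_mem_pow_notMem (minimalPrimes.finite_of_isNoetherianRing R)
      (fun P hP ↦ hP.isPrime) (fun P hP h ↦ hM (h ▸ hP)) y₀ 2
    have hy : y₀ + r ∈ maximalIdeal R := Ideal.add_mem _ hy₀ (Ideal.pow_le_self two_ne_zero hr)
    have hy2 : y₀ + r ∉ maximalIdeal R ^ 2 := fun h ↦ hy₀2 ((Ideal.add_mem_iff_left _ hr).mp h)
    generalize y₀ + r = y at hy hy2 hrT
    obtain ⟨x', hx'⟩ := exists_span_pair_eq_maximalIdeal hx hy hy2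
    have := isLocalRing_quotient_span_singleton hy
    have hdom := ih (ringKrullDim_quotient_eq hdim hx') (span_range_mk_eq_maximalIdeal hx')
    have hyp := (Ideal.Quotient.isDomain_iff_prime _).mp hdom
    obtain ⟨p, hp, hle⟩ := Ideal.exists_minimalPrimes_le (bot_le (a := Ideal.span {y}))
    have hpp := hp.isPrime
    have hp0 : p = ⊥ := by
      refine Submodule.eq_bot_of_le_smul_of_le_jacobson_bot (maximalIdeal R) p
        (IsNoetherian.noetherian _) (fun q hq ↦ ?_) (maximalIdeal_le_jacobson _)
      obtain ⟨c, rfl⟩ := Ideal.mem_span_singleton'.mp (hle hq)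
      rw [mul_comm, smul_eq_mul]
      exact Ideal.mul_mem_mul hy ((hpp.mem_or_mem hq).resolve_right (hrT p hp))
    rw [hp0] at hpp
    exact IsDomain.of_bot_isPrime R

lemma exists_regular_notMem_sq {R : Type*} [CommRing R] [IsLocalRing R] [IsNoetherianRing R]
    {J : Ideal R} (hJ : SocleFree J) (hbot : maximalIdeal R ≠ ⊥) :
    ∃ y ∈ maximalIdeal R, y ∉ maximalIdeal R ^ 2 ∧ ∀ t, y * t ∈ J → t ∈ J := by
  obtain ⟨y₀, hy₀, hy₀2⟩ := exists_mem_maximalIdeal_notMem_sq hbot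
  obtain ⟨r, hr, hreg⟩ := hJ.exists_add_regular y₀ 2
  exact ⟨y₀ + r, Ideal.add_mem _ hy₀ (Ideal.pow_le_self two_ne_zero hr),
    fun h ↦ hy₀2 ((Ideal.add_mem_iff_left _ hr).mp h), hreg⟩

lemma socleFree_of_regular {R : Type*} [CommRing R] [IsLocalRing R] {J : Ideal R} {s : R}
    (hs : s ∈ maximalIdeal R) (hreg : ∀ t, s * t ∈ J → t ∈ J) : SocleFree J :=
  fun t ht ↦ hreg t (mul_comm t s ▸ ht s hs)

lemma mk_isWeaklyRegular_of_regular {R : Type*} [CommRing R] [IsLocalRing R] [IsNoetherianRing R]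
    {L : List R} (hL : IsWeaklyRegular R L) (hLM : ∀ b ∈ L, b ∈ maximalIdeal R) {y : R}
    (hy : y ∈ maximalIdeal R) (hreg : ∀ t, y * t ∈ Ideal.ofList L → t ∈ Ideal.ofList L) :
    IsWeaklyRegular (R ⧸ Ideal.span {y}) (L.map (Ideal.Quotient.mk (Ideal.span {y}))) := by
  have h := (isWeaklyRegular_append_singleton_iff L y).mpr ⟨hL, hreg⟩
  have hp : (L ++ [y]).Perm (y :: L) := by simp
  have := isWeaklyRegular_of_perm_of_subset_maximalIdeal h hp (by
    simp only [List.mem_append, List.mem_singleton]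
    rintro r (hr | rfl)
    exacts [hLM r hr, hy])
  exact ((isWeaklyRegular_cons_iff_quotient y L).mp this).2

lemma mk_mem_ofList_map_iff {R : Type*} [CommRing R] (y : R) (L : List R) (t : R) :
    Ideal.Quotient.mk (Ideal.span {y}) t ∈
      Ideal.ofList (L.map (Ideal.Quotient.mk (Ideal.span {y}))) ↔
      t ∈ Ideal.span {y} ⊔ Ideal.ofList L := by
  rw [← Ideal.map_ofList, ← Ideal.mem_comap,
    Ideal.comap_map_of_surjective' _ Ideal.Quotient.mk_surjective, Ideal.mk_ker, sup_comm]

/-- In a regular local ring, a regular sequence shorter than the dimension leaves no socle. For a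
sequence `L, c` one chooses `y ∈ M \ M ^ 2` regular modulo `L`; exchanging `c` for `y` does not affect
whether there is a socle, and the sequence `L, y` is treated by induction in `R / (y)`. -/
theorem socleFree_of_isWeaklyRegular {R : Type*} [CommRing R] [IsLocalRing R]
    [IsNoetherianRing R] {n : ℕ} (hdim : ringKrullDim R = n)
    {x : Fin n → R} (hx : Ideal.span (Set.range x) = maximalIdeal R)
    {L : List R} (hL : IsWeaklyRegular R L) (hLM : ∀ b ∈ L, b ∈ maximalIdeal R)
    (hlen : L.length < n) : SocleFree (Ideal.ofList L) := by
  have hbot : maximalIdeal R ≠ ⊥ := fun h ↦ by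
    have h0 := ringKrullDim_eq_zero_of_isField (isField_iff_maximalIdeal_eq.mpr h)
    rw [hdim] at h0
    norm_cast at h0
    omega
  induction hl : L.length generalizing R n with
  | zero =>
    obtain rfl := List.length_eq_zero_iff.mp hl
    have := isDomain_of_span_range_eq_maximalIdeal hdim hx
    obtain ⟨m, hm, hm0⟩ := Submodule.exists_mem_ne_zero_of_ne_bot hbot
    intro t ht
    simpa [hm0] using ht m hm
  | succ l ih =>
    obtain ⟨L', c, rfl⟩ : ∃ L' c, L = L' ++ [c] :=
      ⟨L.dropLast, L.getLast (by rintro rfl; simp at hl), (List.dropLast_append_getLast _).symm⟩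
    obtain ⟨n, rfl⟩ : ∃ k, n = k + 1 := ⟨n - 1, by omega⟩
    have hlen' : L'.length = l := by simpa using hl
    obtain ⟨hL', hc⟩ := (isWeaklyRegular_append_singleton_iff L' c).mp hL
    have hcM : c ∈ maximalIdeal R := hLM c (by simp)
    have hLM' : ∀ b ∈ L', b ∈ maximalIdeal R := fun b hb ↦ hLM b (by simp [hb])
    obtain ⟨y, hy, hy2, hyreg⟩ := exists_regular_notMem_sq (socleFree_of_regular hcM hc) hbot
    obtain ⟨x', hx'⟩ := exists_span_pair_eq_maximalIdeal hx hy hy2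
    have := isLocalRing_quotient_span_singleton hy
    have hdim' := ringKrullDim_quotient_eq hdim hx'
    have hlt : l < n := by simp at hlen; omega
    have hsf := ih hdim' (span_range_mk_eq_maximalIdeal hx')
      (mk_isWeaklyRegular_of_regular hL' hLM' hy hyreg)
      (by
        simp only [List.mem_map]
        rintro _ ⟨b, hb, rfl⟩
        exact (mk_mem_maximalIdeal_iff b).mpr (hLM' b hb))
      (by simpa [hlen'] using hlt)
      (fun h ↦ by
        have h0 := ringKrullDim_eq_zero_of_isField (isField_iff_maximalIdeal_eq.mpr h)
        rw [hdim'] at h0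
        norm_cast at h0
        omega) (by simpa using hlen')
    intro t ht
    rw [Ideal.ofList_append, Ideal.ofList_singleton] at ht ⊢
    -- A socle element `t` modulo `(L', c)` gives the socle element `u = t y / c` modulo `(L', y)`.
    obtain ⟨u, hu⟩ : ∃ u, t * y - c * u ∈ Ideal.ofList L' := by
      obtain ⟨j, hj, z, hz, h⟩ := Submodule.mem_sup.mp (ht y hy)
      obtain ⟨u, rfl⟩ := Ideal.mem_span_singleton'.mp hz
      exact ⟨u, by rw [← h]; convert hj using 1; ring⟩
    have huy : u ∈ Ideal.span {y} ⊔ Ideal.ofList L' := by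
      rw [← mk_mem_ofList_map_iff]
      refine hsf _ fun m hm ↦ ?_
      obtain ⟨m, rfl⟩ := Ideal.Quotient.mk_surjective m
      rw [mk_mem_maximalIdeal_iff] at hm
      rw [← map_mul, mk_mem_ofList_map_iff]
      obtain ⟨j, hj, z, hz, h⟩ := Submodule.mem_sup.mp (ht m hm)
      obtain ⟨v, rfl⟩ := Ideal.mem_span_singleton'.mp hz
      have : u * m - y * v ∈ Ideal.ofList L' := hc _ <| by
        have h1 := Ideal.sub_mem _ (Ideal.mul_mem_left _ y hj) (Ideal.mul_mem_left _ m hu)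
        convert h1 using 1
        linear_combination -y * h
      rw [show u * m = y * v + (u * m - y * v) by ring]
      exact Submodule.add_mem_sup (Ideal.mem_span_singleton.mpr (dvd_mul_right _ _)) this
    obtain ⟨z, hz, j, hj, rfl⟩ := Submodule.mem_sup.mp huy
    obtain ⟨v, rfl⟩ := Ideal.mem_span_singleton'.mp hz
    have : t - c * v ∈ Ideal.ofList L' := hyreg _ <| by
      convert Ideal.add_mem _ hu (Ideal.mul_mem_left _ c hj) using 1
      ring
    rw [show t = (t - c * v) + c * v by ring]
    exact Submodule.add_mem_sup this (Ideal.mem_span_singleton.mpr (dvd_mul_right _ _))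

/-! ### The determinant generates the socle -/

lemma vecMul_adjugate {R : Type*} [CommRing R] {n : ℕ} (x : Fin n → R)
    (φ : Matrix (Fin n) (Fin n) R) :
    Matrix.vecMul (Matrix.vecMul x φ) φ.adjugate = φ.det • x := by
  rw [Matrix.vecMul_vecMul, Matrix.mul_adjugate, Matrix.vecMul_smul, Matrix.vecMul_one]

lemma vecMul_mem_span_range {R : Type*} [CommRing R] {n p : ℕ} (x : Fin n → R)
    (φ : Matrix (Fin n) (Fin p) R) (j : Fin p) :
    Matrix.vecMul x φ j ∈ Ideal.span (Set.range x) := by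
  rw [Matrix.vecMul, dotProduct]
  exact Ideal.sum_mem _ fun i _ ↦ Ideal.mul_mem_right _ _ (Ideal.subset_span ⟨i, rfl⟩)

/-- Cramer's rule: `det φ` multiplies `J(x)` into `J(x φ)`. -/
lemma det_mul_mem {R : Type*} [CommRing R] {n : ℕ} (x : Fin n → R)
    (φ : Matrix (Fin n) (Fin n) R) {m : R} (hm : m ∈ Ideal.span (Set.range x)) :
    φ.det * m ∈ Ideal.span (Set.range (Matrix.vecMul x φ)) := by
  induction hm using Submodule.span_induction with
  | zero => simp
  | add u v _ _ hu hv => rw [mul_add]; exact Ideal.add_mem _ hu hv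
  | smul c v _ hv => rw [smul_eq_mul, mul_left_comm]; exact Ideal.mul_mem_left _ _ hv
  | mem v hv =>
    obtain ⟨i, rfl⟩ := hv
    rw [← smul_eq_mul, ← Pi.smul_apply, ← vecMul_adjugate]
    exact vecMul_mem_span_range _ _ _

lemma Ideal.span_range_succAbove {R : Type*} [CommRing R] {n : ℕ} (a : Fin (n + 1) → R)
    (i : Fin (n + 1)) : Ideal.span (Set.range a) =
      Ideal.span {a i} ⊔ Ideal.span (Set.range fun j ↦ a (i.succAbove j)) := by
  rw [← Ideal.span_union]
  congr 1
  ext t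
  simp [Fin.exists_iff_succAbove i, eq_comm]

lemma exists_eq_vecMul {R : Type*} [CommRing R] {n p : ℕ} {x : Fin n → R} {a : Fin p → R}
    (h : ∀ j, a j ∈ Ideal.span (Set.range x)) :
    ∃ B : Matrix (Fin n) (Fin p) R, Matrix.vecMul x B = a := by
  choose c hc using fun j ↦ Ideal.mem_span_range_iff_exists_fun.mp (h j)
  refine ⟨.of fun i j ↦ c j i, funext fun j ↦ ?_⟩
  simp [Matrix.vecMul, dotProduct, ← hc, mul_comm]

/-- The coordinate `0` of Cramer's rule `(x φ) adj(φ) = det φ • x`, reduced modulo the entries of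
`x φ` other than the one at `0`. -/
lemma det_submatrix_succ_mul_sub_mem {R : Type*} [CommRing R] {n : ℕ} (x : Fin (n + 1) → R)
    (φ : Matrix (Fin (n + 1)) (Fin (n + 1)) R) :
    (φ.submatrix Fin.succ Fin.succ).det * Matrix.vecMul x φ 0 - φ.det * x 0 ∈
      Ideal.span (Set.range fun j ↦ Matrix.vecMul x φ (Fin.succ j)) := by
  have h := congrFun (vecMul_adjugate x φ) 0
  have h0 : φ.adjugate 0 0 = (φ.submatrix Fin.succ Fin.succ).det := by
    rw [Matrix.adjugate_fin_succ_eq_det_submatrix]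
    simp
  rw [Pi.smul_apply, smul_eq_mul] at h
  rw [← h]
  generalize Matrix.vecMul x φ = a
  rw [Matrix.vecMul, dotProduct, Fin.sum_univ_succ, h0, mul_comm, sub_add_cancel_left]
  exact Ideal.neg_mem_iff _ |>.mpr <| Ideal.sum_mem _ fun j _ ↦
    Ideal.mul_mem_right _ _ (Ideal.subset_span ⟨j, rfl⟩)

/-- If `x` generates the maximal ideal `M` and `a = x φ` is a regular sequence of the same length,
then the class of `det φ` in `R / J(a)` is nonzero and generates the socle. -/
theorem det_notMem_and_colon_le {R : Type*} [CommRing R] [IsLocalRing R]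
    [IsNoetherianRing R] {n : ℕ} {x : Fin n → R}
    (hx : Ideal.span (Set.range x) = maximalIdeal R) (φ : Matrix (Fin n) (Fin n) R)
    (hreg : IsWeaklyRegular R (List.ofFn (Matrix.vecMul x φ))) :
    φ.det ∉ Ideal.span (Set.range (Matrix.vecMul x φ)) ∧
      ∀ t, (∀ m ∈ maximalIdeal R, t * m ∈ Ideal.span (Set.range (Matrix.vecMul x φ))) →
        t ∈ Ideal.span (Set.range (Matrix.vecMul x φ)) ⊔ Ideal.span {φ.det} := by
  induction n generalizing R with
  | zero => simp
  | succ n ih =>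
    have haM : ∀ j, Matrix.vecMul x φ j ∈ maximalIdeal R := fun j ↦
      hx ▸ vecMul_mem_span_range x φ j
    obtain ⟨a, ha⟩ : ∃ a, Matrix.vecMul x φ = a := ⟨_, rfl⟩
    rw [ha] at haM hreg ⊢
    have hJ' := Ideal.ofList_ofFn fun j ↦ a (Fin.succ j)
    obtain ⟨hreg', h0⟩ := (isWeaklyRegular_append_singleton_iff
      (List.ofFn fun j ↦ a (Fin.succ j)) (a 0)).mp <|
        isWeaklyRegular_of_perm_of_subset_maximalIdeal hreg
          (List.ofFn_succ (f := a) ▸ (List.perm_append_singleton _ _).symm)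
          (by simpa only [List.forall_mem_ofFn_iff] using haM)
    have hJM : Ideal.span (Set.range fun j ↦ a (Fin.succ j)) ≤ maximalIdeal R := by
      rw [Ideal.span_le]
      rintro _ ⟨j, rfl⟩
      exact haM _
    have hbot : maximalIdeal R ≠ ⊥ := fun h ↦ by
      have ha0 : a 0 = 0 := by simpa [h] using haM 0
      exact (Ideal.ne_top_iff_one _).mp (maximalIdeal.isMaximal R).ne_top
        (hJM (hJ' ▸ h0 1 (by simp [ha0])))
    obtain ⟨y, hy, hy2, hyreg⟩ := exists_regular_notMem_sq (socleFree_of_regular (haM 0) h0) hbot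
    obtain ⟨x', hx'⟩ := exists_span_pair_eq_maximalIdeal hx hy hy2
    have := isLocalRing_quotient_span_singleton hy
    have hreg'' := mk_isWeaklyRegular_of_regular hreg'
      (by simpa [List.mem_ofFn] using fun j ↦ haM (Fin.succ j)) hy hyreg
    rw [hJ'] at h0 hyreg
    -- For the generators `(y, x')`, `φ` is replaced by `Φ = B φ`, whose determinant is a multiple of
    -- `det φ`; so both assertions for `Φ` imply those for `φ`.
    obtain ⟨B, hB⟩ := exists_eq_vecMul (x := (Fin.cons y x' : Fin (n + 1) → R)) (a := x) fun j ↦ by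
      rw [Ideal.span_range_succAbove _ 0]
      simp only [Fin.cons_zero, Fin.zero_succAbove, Fin.cons_succ]
      rw [hx', ← hx]
      exact Ideal.subset_span ⟨j, rfl⟩
    obtain ⟨Φ, hΦ⟩ : ∃ Φ, B * φ = Φ := ⟨_, rfl⟩
    have hΦa : Matrix.vecMul (Fin.cons y x' : Fin (n + 1) → R) Φ = a := by
      rw [← hΦ, ← Matrix.vecMul_vecMul, hB, ha]
    have hdet : Φ.det ∈ Ideal.span {φ.det} := by
      rw [← hΦ, Matrix.det_mul]
      exact Ideal.mul_mem_left _ _ (Ideal.mem_span_singleton_self _)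
    suffices h : Φ.det ∉ Ideal.span (Set.range a) ∧
        ∀ t, (∀ m ∈ maximalIdeal R, t * m ∈ Ideal.span (Set.range a)) →
          t ∈ Ideal.span (Set.range a) ⊔ Ideal.span {Φ.det} by
      refine ⟨fun hφ ↦ h.1 ?_, fun t ht ↦ ?_⟩
      · exact (Ideal.span_singleton_le_iff_mem _).mpr hφ hdet
      · exact sup_le_sup_left ((Ideal.span_singleton_le_iff_mem _).mpr hdet) _ (h.2 t ht)
    have hδ := det_submatrix_succ_mul_sub_mem (Fin.cons y x' : Fin (n + 1) → R) Φ
    rw [hΦa, Fin.cons_zero] at hδ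
    have hvec : Matrix.vecMul (fun i ↦ Ideal.Quotient.mk (Ideal.span {y}) (x' i))
        ((Ideal.Quotient.mk (Ideal.span {y})).mapMatrix (Φ.submatrix Fin.succ Fin.succ)) =
          fun j ↦ Ideal.Quotient.mk (Ideal.span {y}) (a (Fin.succ j)) := by
      funext j
      have hy0 : Ideal.Quotient.mk (Ideal.span {y}) y = 0 :=
        Ideal.Quotient.eq_zero_iff_mem.mpr (Ideal.mem_span_singleton_self y)
      simp [← hΦa, Matrix.vecMul, dotProduct, Fin.sum_univ_succ, hy0]
    obtain ⟨ih1, ih2⟩ := ih (span_range_mk_eq_maximalIdeal hx')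
      ((Ideal.Quotient.mk (Ideal.span {y})).mapMatrix (Φ.submatrix Fin.succ Fin.succ))
      (by rw [hvec]; simpa [List.map_ofFn, Function.comp_def] using hreg'')
    rw [hvec, ← RingHom.map_det] at ih1 ih2
    rw [mk_mem_span_range_iff] at ih1
    rw [Ideal.span_range_succAbove _ 0]
    simp only [Fin.zero_succAbove]
    generalize (Φ.submatrix Fin.succ Fin.succ).det = δ at hδ ih1 ih2
    generalize Φ.det = D at hδ
    set J := Ideal.span (Set.range fun j ↦ a (Fin.succ j))
    have hmem {b t : R} (h : t ∈ Ideal.span {b} ⊔ J) : ∃ u, t - b * u ∈ J := by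
      obtain ⟨z, hz, j, hj, rfl⟩ := Submodule.mem_sup.mp h
      obtain ⟨u, rfl⟩ := Ideal.mem_span_singleton'.mp hz
      exact ⟨u, by convert hj using 1; ring⟩
    have hmem' {b u j : R} (h : j ∈ J) : b * u + j ∈ Ideal.span {b} ⊔ J :=
      Submodule.add_mem_sup (Ideal.mem_span_singleton.mpr (dvd_mul_right _ _)) h
    constructor
    · intro hD
      obtain ⟨s, hs⟩ := hmem hD
      have : δ - y * s ∈ J := h0 _ <| by
        convert Ideal.add_mem _ hδ (Ideal.mul_mem_left _ y hs) using 1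
        ring
      exact ih1 (by convert hmem' (b := y) (u := s) this using 1; ring)
    · intro t ht
      obtain ⟨u, hu⟩ := hmem (ht y hy)
      have hu' := ih2 (Ideal.Quotient.mk _ u) fun m hm ↦ by
        obtain ⟨m, rfl⟩ := Ideal.Quotient.mk_surjective m
        rw [mk_mem_maximalIdeal_iff] at hm
        rw [← map_mul, mk_mem_span_range_iff]
        obtain ⟨v, hv⟩ := hmem (ht m hm)
        have : u * m - y * v ∈ J := h0 _ <| by
          convert Ideal.sub_mem _ (Ideal.mul_mem_left _ y hv) (Ideal.mul_mem_left _ m hu) using 1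
          ring
        convert hmem' (b := y) (u := v) this using 1
        ring
      obtain ⟨j, hj, z, hz, hjz⟩ := Submodule.mem_sup.mp hu'
      obtain ⟨c, rfl⟩ := Ideal.mem_span_singleton'.mp hz
      obtain ⟨c, rfl⟩ := Ideal.Quotient.mk_surjective c
      obtain ⟨d, hd⟩ := hmem (b := y) (t := u - c * δ) <| by
        rw [← mk_mem_span_range_iff]
        convert hj using 1
        rw [map_sub, map_mul, ← hjz, add_sub_cancel_right]
      have : t - a 0 * d - D * c ∈ J := hyreg _ <| by
        convert Ideal.add_mem _ (Ideal.add_mem _ hu (Ideal.mul_mem_left _ (a 0) hd))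
          (Ideal.mul_mem_left _ c hδ) using 1
        ring
      rw [show t = (a 0 * d + (t - a 0 * d - D * c)) + D * c by ring]
      exact Submodule.add_mem_sup (hmem' this) (Ideal.mem_span_singleton.mpr (dvd_mul_right _ _))

/-! ### Perturbing a sequence into a regular one -/

lemma exists_isWeaklyRegular_add {R : Type*} [CommRing R] [IsLocalRing R] [IsNoetherianRing R]
    {n : ℕ} (hdim : ringKrullDim R = n) {x : Fin n → R}
    (hx : Ideal.span (Set.range x) = maximalIdeal R) {p : ℕ} (hp : p ≤ n) {a : Fin p → R}
    (ha : ∀ j, a j ∈ maximalIdeal R) (k : ℕ) :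
    ∃ e : Fin p → R, (∀ j, e j ∈ maximalIdeal R ^ (k + 1)) ∧
      IsWeaklyRegular R (List.ofFn fun j ↦ a j + e j) := by
  induction p with
  | zero => exact ⟨0, fun j ↦ j.elim0, by simp⟩
  | succ p ih =>
    obtain ⟨e, he, hreg⟩ := ih (by omega) fun j ↦ ha j.castSucc
    have hsf := socleFree_of_isWeaklyRegular hdim hx hreg
      (by
        rw [List.forall_mem_ofFn_iff]
        exact fun j ↦ Ideal.add_mem _ (ha _) (Ideal.pow_le_self (Nat.succ_ne_zero k) (he j)))
      (by simpa using hp)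
    obtain ⟨r, hr, hr'⟩ := hsf.exists_add_regular (a (Fin.last p)) (k + 1)
    refine ⟨Fin.snoc e r, fun j ↦ ?_, ?_⟩
    · refine Fin.lastCases ?_ (fun j ↦ ?_) j
      · simpa using hr
      · simpa using he j
    · rw [List.ofFn_succ', List.concat_eq_append, isWeaklyRegular_append_singleton_iff]
      simp only [Fin.snoc_castSucc, Fin.snoc_last]
      exact ⟨hreg, hr'⟩

lemma List.ofFn_perm_succAbove {α : Type*} {n : ℕ} (f : Fin (n + 1) → α) (i : Fin (n + 1)) :
    (List.ofFn f).Perm ((List.ofFn fun j ↦ f (i.succAbove j)) ++ [f i]) := by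
  refine .trans (Multiset.coe_eq_coe.mp ?_) (List.perm_append_singleton _ _).symm
  rw [← Multiset.cons_coe, ← Fin.univ_val_map, ← Fin.univ_val_map, Fin.univ_succAbove n i]
  simp [Function.comp_def]

/-- Changing one entry of a regular sequence `f` by an element of `M J(f)` preserves regularity and
`J(f)`: modulo the other entries, the entry is multiplied by a unit. -/
lemma isWeaklyRegular_update {R : Type*} [CommRing R] [IsLocalRing R] [IsNoetherianRing R] {n : ℕ}
    {f : Fin n → R} (hf : IsWeaklyRegular R (List.ofFn f)) (hfM : ∀ j, f j ∈ maximalIdeal R)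
    (i : Fin n) {b : R} (hb : b - f i ∈ maximalIdeal R * Ideal.span (Set.range f)) :
    Ideal.span (Set.range (Function.update f i b)) = Ideal.span (Set.range f) ∧
      IsWeaklyRegular R (List.ofFn (Function.update f i b)) := by
  obtain ⟨n, rfl⟩ : ∃ k, n = k + 1 := ⟨n - 1, by have := i.2; omega⟩
  have hbM : b ∈ maximalIdeal R := by
    have := Ideal.add_mem _ (Ideal.mul_le_left hb) (hfM i)
    simpa using this
  rw [Ideal.span_range_succAbove f i, Ideal.mul_sup] at hb
  obtain ⟨z, hz, j, hj, hzj⟩ := Submodule.mem_sup.mp hb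
  obtain ⟨m, hm, rfl⟩ := Ideal.mem_mul_span_singleton.mp hz
  replace hj := Ideal.mul_le_right hj
  have hu : IsUnit (1 + m) := by
    by_contra hu
    have := Ideal.sub_mem _ ((mem_maximalIdeal _).mpr hu) hm
    simp at this
  have hbeq : b = (1 + m) * f i + j := by linear_combination -hzj
  obtain ⟨hf', hfi⟩ := (isWeaklyRegular_append_singleton_iff _ _).mp <|
    isWeaklyRegular_of_perm_of_subset_maximalIdeal hf (List.ofFn_perm_succAbove f i)
      (by simpa only [List.forall_mem_ofFn_iff] using hfM)
  constructor
  · rw [Ideal.span_range_succAbove f i, Ideal.span_range_succAbove _ i]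
    simp only [Function.update_self, ne_eq, Fin.succAbove_ne, not_false_eq_true,
      Function.update_of_ne]
    refine le_antisymm (sup_le ?_ le_sup_right) (sup_le ?_ le_sup_right)
    · rw [Ideal.span_singleton_le_iff_mem, hbeq]
      exact Submodule.add_mem_sup
        (Ideal.mul_mem_left _ _ (Ideal.mem_span_singleton_self _)) hj
    · rw [Ideal.span_singleton_le_iff_mem, ← Ideal.unit_mul_mem_iff_mem _ hu,
        show (1 + m) * f i = b + -j by rw [hbeq]; ring]
      exact Submodule.add_mem_sup (Ideal.mem_span_singleton_self _) (neg_mem hj)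
  · refine isWeaklyRegular_of_perm_of_subset_maximalIdeal
      (rs := (List.ofFn fun j ↦ f (i.succAbove j)) ++ [b]) ?_ ?_ ?_
    · refine (isWeaklyRegular_append_singleton_iff _ _).mpr ⟨hf', fun t ht ↦ hfi t ?_⟩
      rw [Ideal.ofList_ofFn] at ht ⊢
      rw [← Ideal.unit_mul_mem_iff_mem _ hu]
      convert Ideal.sub_mem _ ht (Ideal.mul_mem_right t _ hj) using 1
      rw [hbeq]
      ring
    · have := (List.ofFn_perm_succAbove (Function.update f i b) i).symm
      simpa using this
    · simp only [List.mem_append, List.mem_singleton, List.mem_ofFn]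
      rintro r (⟨j, rfl⟩ | rfl)
      exacts [hfM _, hbM]

lemma isWeaklyRegular_of_sub_mem {R : Type*} [CommRing R] [IsLocalRing R] [IsNoetherianRing R]
    {n : ℕ} {c a : Fin n → R} (hc : IsWeaklyRegular R (List.ofFn c))
    (hcM : ∀ j, c j ∈ maximalIdeal R) (haM : ∀ j, a j ∈ maximalIdeal R)
    (h : ∀ j, a j - c j ∈ maximalIdeal R * Ideal.span (Set.range c)) :
    IsWeaklyRegular R (List.ofFn a) := by
  suffices H : ∀ T : Finset (Fin n), Ideal.span (Set.range (T.piecewise a c)) =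
      Ideal.span (Set.range c) ∧ IsWeaklyRegular R (List.ofFn (T.piecewise a c)) by
    simpa using (H Finset.univ).2
  intro T
  induction T using Finset.induction_on with
  | empty => simpa using hc
  | insert i T hi ih =>
    rw [Finset.piecewise_insert]
    have := isWeaklyRegular_update ih.2 (fun j ↦ by
      by_cases hj : j ∈ T <;> simp [-mem_maximalIdeal, hj, hcM, haM]) i (b := a i)
      (by rw [ih.1, Finset.piecewise_eq_of_notMem _ _ _ hi]; exact h i)
    exact ⟨this.1.trans ih.1, this.2⟩

/-! ### Regular sequences of maximal length and minimal generators -/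

lemma exists_pow_maximalIdeal_le {R : Type*} [CommRing R] [IsLocalRing R] [IsNoetherianRing R]
    {n : ℕ} (hdim : ringKrullDim R = n) {c : Fin n → R} (hc : IsWeaklyRegular R (List.ofFn c))
    (hcM : ∀ j, c j ∈ maximalIdeal R) :
    ∃ N, maximalIdeal R ^ N ≤ Ideal.span (Set.range c) := by
  have hc' : IsRegular R (List.ofFn c) :=
    .of_isWeaklyRegular_of_mem_maximalIdeal R (by simpa only [List.forall_mem_ofFn_iff] using hcM) hc
  have h := ringKrullDim_add_length_eq_ringKrullDim_of_isRegular _ hc'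
  rw [Ideal.ofList_ofFn, List.length_ofFn, hdim] at h
  have hne : Ideal.span (Set.range c) ≠ ⊤ := by
    refine ne_top_of_le_ne_top (maximalIdeal.isMaximal R).ne_top (Ideal.span_le.mpr ?_)
    rintro _ ⟨j, rfl⟩
    exact hcM j
  generalize Ideal.span (Set.range c) = J at h hne
  have := Ideal.Quotient.nontrivial_iff.mpr hne
  have : IsLocalRing (R ⧸ J) := .of_surjective' _ Ideal.Quotient.mk_surjective
  have h0 : ringKrullDim (R ⧸ J) ≤ 0 := by
    revert h
    generalize ringKrullDim (R ⧸ J) = d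
    intro h
    induction d with
    | bot => simp
    | coe d =>
      norm_cast at h ⊢
      have : d ≠ ⊤ := by rintro rfl; simp at h
      lift d to ℕ using this
      norm_cast at h ⊢
      omega
  have : Ring.KrullDimLE 0 (R ⧸ J) := Order.krullDimLE_iff _ _ |>.mpr (by exact_mod_cast h0)
  have hart : IsArtinianRing (R ⧸ J) := isArtinianRing_iff_krullDimLE_zero.mpr this
  obtain ⟨N, hN⟩ := (isArtinianRing_iff_isNilpotent_maximalIdeal _).mp hart
  refine ⟨N, ?_⟩
  rw [← Ideal.mk_ker (I := J), ← Ideal.map_eq_bot_iff_le_ker, Ideal.map_pow, eq_bot_iff]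
  refine (Ideal.pow_right_mono (Ideal.map_le_iff_le_comap.mpr fun m hm ↦ ?_) N).trans hN.le
  exact (mk_mem_maximalIdeal_iff m).mpr hm

lemma Ideal.exists_notMem_sup_pow {R : Type*} [CommRing R] [IsLocalRing R] [IsNoetherianRing R]
    {J : Ideal R} {t : R} (ht : t ∉ J) : ∃ k, t ∉ J ⊔ maximalIdeal R ^ k := by
  by_contra! h
  have hbot := Ideal.iInf_pow_smul_eq_bot_of_isLocalRing (M := R ⧸ J) (maximalIdeal R)
    (maximalIdeal.isMaximal R).ne_top
  refine ht (Ideal.Quotient.eq_zero_iff_mem.mp ?_)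
  rw [← Submodule.mem_bot R, ← hbot, Submodule.mem_iInf]
  intro k
  obtain ⟨j, hj, z, hz, rfl⟩ := Submodule.mem_sup.mp (h k)
  rw [map_add, Ideal.Quotient.eq_zero_iff_mem.mpr hj, zero_add,
    show Ideal.Quotient.mk J z = z • (1 : R ⧸ J) by rw [Algebra.smul_def, mul_one]; rfl]
  exact Submodule.smul_mem_smul hz trivial

lemma card_le_finrank_of_minimal {R : Type*} [CommRing R] [IsLocalRing R] [IsNoetherianRing R]
    {n : ℕ} {x : Fin n → R} (hx : GeneratesMinimally x (maximalIdeal R)) :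
    n ≤ (maximalIdeal R).spanFinrank := by
  have hxm (i) : x i ∈ maximalIdeal R := hx.1 ▸ Ideal.subset_span ⟨i, rfl⟩
  let w : Fin n → maximalIdeal R := fun i ↦ ⟨x i, hxm i⟩
  have himg (s : Set (Fin n)) : Submodule.span R (w '' s) = ⊤ ↔ Ideal.span (x '' s) =
      maximalIdeal R := by
    rw [← (Submodule.map_injective_of_injective (maximalIdeal R).injective_subtype).eq_iff,
      Submodule.map_span, Submodule.map_top, Submodule.range_subtype, ← Set.image_comp]
    rfl
  have hli : LinearIndependent (ResidueField R) (fun i ↦ (maximalIdeal R).toCotangent (w i)) := by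
    rw [linearIndependent_iff_notMem_span]
    intro i hi
    refine hx.2 i ((himg _).mp ?_)
    rw [← CotangentSpace.span_image_eq_top_iff, eq_top_iff]
    have htop := CotangentSpace.span_image_eq_top_iff.mpr ((himg Set.univ).mpr
      (by rw [Set.image_univ]; exact hx.1))
    rw [← htop, Submodule.span_le]
    rintro _ ⟨_, ⟨j, -, rfl⟩, rfl⟩
    rw [← Set.image_comp]
    by_cases hj : j = i
    · subst hj
      rw [show Set.univ \ {j} = {k | k ≠ j} by ext; simp] at hi
      exact hi
    · exact Submodule.subset_span ⟨j, hj, rfl⟩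
  rw [spanFinrank_maximalIdeal_eq_finrank_cotangentSpace]
  simpa using hli.fintype_card_le_finrank

/-! ### Regularity from the determinant -/

/-- For regular `a = x φ` of length `dim R`, the ideal `(M ^ k + J(a)) / J(a)` of the Artinian ring
`R / J(a)`, if nonzero, contains a nonzero socle element and hence the generator `det φ` of the
socle. -/
lemma det_mem_sup_pow {R : Type*} [CommRing R] [IsLocalRing R] [IsNoetherianRing R]
    {n : ℕ} (hdim : ringKrullDim R = n) {x : Fin n → R}
    (hx : Ideal.span (Set.range x) = maximalIdeal R) (φ : Matrix (Fin n) (Fin n) R)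
    (hreg : IsWeaklyRegular R (List.ofFn (Matrix.vecMul x φ))) {k : ℕ}
    (hk : ¬ maximalIdeal R ^ k ≤ Ideal.span (Set.range (Matrix.vecMul x φ))) :
    φ.det ∈ Ideal.span (Set.range (Matrix.vecMul x φ)) ⊔ maximalIdeal R ^ k := by
  obtain ⟨N, hN⟩ := exists_pow_maximalIdeal_le hdim hreg fun j ↦ hx ▸ vecMul_mem_span_range x φ j
  have hcolon := (det_notMem_and_colon_le hx φ hreg).2
  have hdetM (m) (hm : m ∈ maximalIdeal R) := det_mul_mem x φ (hx.symm ▸ hm : m ∈ _)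
  generalize Ideal.span (Set.range (Matrix.vecMul x φ)) = J at *
  obtain ⟨t, htk, htJ, ht⟩ : ∃ t ∈ maximalIdeal R ^ k, t ∉ J ∧ ∀ m ∈ maximalIdeal R, t * m ∈ J := by
    have hex : ∃ l, maximalIdeal R ^ l ≤ J := ⟨N, hN⟩
    classical
    have hlt : k < Nat.find hex := by
      by_contra! hle
      exact hk ((Ideal.pow_le_pow_right hle).trans (Nat.find_spec hex))
    obtain ⟨l, hl⟩ : ∃ l, Nat.find hex = l + 1 := ⟨Nat.find hex - 1, by omega⟩
    obtain ⟨t, ht, htJ⟩ := SetLike.not_le_iff_exists.mp (Nat.find_min hex (m := l) (by omega))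
    refine ⟨t, Ideal.pow_le_pow_right (by omega) ht, htJ, fun m hm ↦ ?_⟩
    have := Nat.find_spec hex
    rw [hl, pow_succ] at this
    exact this (Ideal.mul_mem_mul ht hm)
  obtain ⟨j, hj, z, hz, rfl⟩ := Submodule.mem_sup.mp (hcolon t ht)
  obtain ⟨c, rfl⟩ := Ideal.mem_span_singleton'.mp hz
  have hc : IsUnit c := by
    by_contra hc
    exact htJ (Ideal.add_mem _ hj (mul_comm c φ.det ▸ hdetM c ((mem_maximalIdeal _).mpr hc)))
  rw [← Ideal.unit_mul_mem_iff_mem _ hc, show c * φ.det = -j + (j + c * φ.det) by ring]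
  exact Submodule.add_mem_sup (neg_mem hj) htk

/-- If `det φ ∉ J(x φ)`, then `x φ` is regular: a regular perturbation `x (φ + ψ)` generates an ideal
containing `M ^ k`, and so absorbs the perturbation. -/
theorem isWeaklyRegular_of_det_notMem {R : Type*} [CommRing R] [IsLocalRing R]
    [IsNoetherianRing R] {n : ℕ} (hdim : ringKrullDim R = n) {x : Fin n → R}
    (hx : Ideal.span (Set.range x) = maximalIdeal R) (φ : Matrix (Fin n) (Fin n) R)
    (hdet : φ.det ∉ Ideal.span (Set.range (Matrix.vecMul x φ))) :
    IsWeaklyRegular R (List.ofFn (Matrix.vecMul x φ)) := by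
  have haM (φ : Matrix (Fin n) (Fin n) R) (j) : Matrix.vecMul x φ j ∈ maximalIdeal R :=
    hx ▸ vecMul_mem_span_range x φ j
  obtain ⟨k, hk⟩ := Ideal.exists_notMem_sup_pow hdet
  obtain ⟨e, he, hreg⟩ := exists_isWeaklyRegular_add hdim hx le_rfl (haM φ) k
  obtain ⟨ψ, hψ, rfl⟩ : ∃ ψ : Matrix (Fin n) (Fin n) R, (∀ i j, ψ i j ∈ maximalIdeal R ^ k) ∧
      Matrix.vecMul x ψ = e := by
    have h (j) : ∃ c : Fin n → R, (∀ i, c i ∈ maximalIdeal R ^ k) ∧ ∑ i, c i * x i = e j := by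
      have := he j
      rw [pow_succ, ← smul_eq_mul] at this
      nth_rw 2 [← hx] at this
      obtain ⟨c, hc, h⟩ := (Submodule.mem_ideal_smul_span_iff_exists_sum _ _ _).mp this
      exact ⟨c, hc, by rw [← h, Finsupp.sum_fintype _ _ (by simp)]; simp⟩
    choose c hc hce using h
    refine ⟨.of fun i j ↦ c j i, fun i j ↦ hc j i, funext fun j ↦ ?_⟩
    simp [Matrix.vecMul, dotProduct, ← hce, mul_comm]
  rw [show (fun j ↦ Matrix.vecMul x φ j + Matrix.vecMul x ψ j) = Matrix.vecMul x (φ + ψ) by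
    rw [Matrix.vecMul_add]; rfl] at hreg
  have hsub (j) : Matrix.vecMul x φ j - Matrix.vecMul x (φ + ψ) j ∈ maximalIdeal R ^ (k + 1) := by
    rw [Matrix.vecMul_add, Pi.add_apply, sub_add_cancel_left]
    exact neg_mem (he j)
  have hdetsub : (φ + ψ).det - φ.det ∈ maximalIdeal R ^ k := by
    rw [← Ideal.Quotient.eq, RingHom.map_det, RingHom.map_det, map_add]
    congr 1
    ext i j
    simpa using Ideal.Quotient.eq_zero_iff_mem.mpr (hψ i j)
  have hle : maximalIdeal R ^ k ≤ Ideal.span (Set.range (Matrix.vecMul x (φ + ψ))) := by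
    by_contra hle
    refine hk ?_
    have h := det_mem_sup_pow hdim hx _ hreg hle
    have hJ : Ideal.span (Set.range (Matrix.vecMul x (φ + ψ))) ≤
        Ideal.span (Set.range (Matrix.vecMul x φ)) ⊔ maximalIdeal R ^ k := by
      rw [Ideal.span_le]
      rintro _ ⟨j, rfl⟩
      rw [show Matrix.vecMul x (φ + ψ) j = Matrix.vecMul x φ j +
        -(Matrix.vecMul x φ j - Matrix.vecMul x (φ + ψ) j) by ring]
      exact Submodule.add_mem_sup (Ideal.subset_span ⟨j, rfl⟩)
        (neg_mem (Ideal.pow_le_pow_right k.le_succ (hsub j)))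
    rw [show φ.det = (φ + ψ).det - ((φ + ψ).det - φ.det) by ring]
    exact sub_mem (sup_le hJ le_sup_right h) (Ideal.mem_sup_right hdetsub)
  refine isWeaklyRegular_of_sub_mem hreg (haM _) (haM _) fun j ↦ ?_
  have := hsub j
  rw [pow_succ'] at this
  exact Ideal.mul_mono_right hle this

theorem proposition2p1 {S : Type*} [CommRing S] [IsRegularLocalRing S] {n : ℕ}
    (x : Fin n → S) (hx : GeneratesMinimally x (IsLocalRing.maximalIdeal S))
    (φ : Matrix (Fin n) (Fin n) S) :
    φ.det ∉ idealOfSeq (Matrix.vecMul x φ) ↔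
      IsMaximalRegularSequence (Matrix.vecMul x φ) := by
  have hspan : Ideal.span (Set.range x) = maximalIdeal S := hx.1
  have hdim : ringKrullDim S = n := by
    refine le_antisymm (ringKrullDim_le_of_span_range_eq_maximalIdeal hspan) ?_
    rw [← IsRegularLocalRing.spanFinrank_maximalIdeal]
    exact_mod_cast card_le_finrank_of_minimal hx
  have haM (j) : Matrix.vecMul x φ j ∈ maximalIdeal S := hspan ▸ vecMul_mem_span_range x φ j
  constructor
  · intro hdet
    refine ⟨.of_isWeaklyRegular_of_mem_maximalIdeal S
      (by simpa only [List.forall_mem_ofFn_iff] using haM)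
      (isWeaklyRegular_of_det_notMem hdim hspan φ hdet), fun s hs ↦ ?_⟩
    have hsM : s ∈ maximalIdeal S := by
      refine (mem_maximalIdeal s).mpr fun hu ↦ hs.top_ne_smul ?_
      rw [Ideal.ofList_append, Ideal.ofList_singleton, Ideal.span_singleton_eq_top.mpr hu]
      simp
    have h := ((isWeaklyRegular_append_singleton_iff _ s).mp hs.toIsWeaklyRegular).2 φ.det
    rw [Ideal.ofList_ofFn, mul_comm] at h
    exact hdet (h (det_mul_mem x φ (hspan ▸ hsM)))
  · exact fun h ↦ (det_notMem_and_colon_le hspan φ h.1.toIsWeaklyRegular).1
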